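/- For $N\ge 3$, let $\mathfrak S_N$ be the group of permutations of $\{1,\dots,N\}$, with identity $e$, and let $\mathfrak A_N$ be its alternating subgroup. For a group $G$ in which every element is a product of elements of $\mathcal T\subseteq G$, let $\ell_{\mathcal T}(g)$ be the least $k$ such that $g$ is a product of $k$ elements of $\mathcal T$, and put $x\le_{\mathcal T}y$ if and only if $\ell_{\mathcal T}(y)=\ell_{\mathcal T}(x)+\ell_{\mathcal T}(x^{-1}y)$; this is a partial order on $G$. Let $\le_{\mathbf 2}$ be this order for $G=\mathfrak S_N$ and $\mathcal T$ the set of all transpositions (the absolute order), and let $\le_{\mathbf 3}$ be this order for $G=\mathfrak A_N$ and $\mathcal T$ the set of all $3$-cycles. Write $[x,y]_{\mathbf 2}$ and $[x,y]_{\mathbf 3}$ for the corresponding intervals. Let $c=(1\;2\;\ldots\;N)$, and let $NC_N=\{x\in\mathfrak S_N : x\le_{\mathbf 2}c\}$ be the set of noncrossing partitions; each cycle of an element of $NC_N$ can be written as $(u_1\;u_2\;\ldots\;u_q)$ with $u_1<u_2<\cdots<u_q$. Let $ONC_N$ be the set of all $x\in NC_N$ such that for every cycle $(u_1<u_2<\cdots<u_q)$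 of $x$ (fixed points included, with $q=1$) the number $q$ is odd and $u_{j+1}-u_j$ is odd for all $1\le j<q$. **Theorem.** Let $N\ge 3$. (1) If all cycles of $x\in\mathfrak A_N$ have odd length, then $([e,x]_{\mathbf 3},\le_{\mathbf 3})$ is an induced subposet of $([e,x]_{\mathbf 2},\le_{\mathbf 2})$: we have $[e,x]_{\mathbf 3}\subseteq[e,x]_{\mathbf 2}$, and $u\le_{\mathbf 3}v$ if and only if $u\le_{\mathbf 2}v$ for all $u,v\in[e,x]_{\mathbf 3}$. (2) $ONC_N\subseteq\mathfrak A_N$, and $(ONC_N,\le_{\mathbf 3})$ is an induced subposet of the noncrossing partition lattice $(NC_N,\le_{\mathbf 2})$: we have $ONC_N\subseteq NC_N$, and $u\le_{\mathbf 3}v$ if and only if $u\le_{\mathbf 2}v$ for all $u,v\in ONC_N$. -/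

import Mathlib

open Equiv

/-- The word length of `g` with respect to a subset `T` of a group: the least `k` such that `g` is
a product of `k` elements of `T`. (It is only used for sets `T` such that every element of the group
is a product of elements of `T`.) -/
noncomputable def wordLength {G : Type*} [Group G] (T : Set G) (g : G) : ℕ :=
  sInf {k : ℕ | ∃ w : List G, w.length = k ∧ (∀ t ∈ w, t ∈ T) ∧ w.prod = g}

theorem exists_reduced_word {G : Type*} [Group G] {T : Set G} (hT : Submonoid.closure T = ⊤)
    (g : G) : ∃ w : List G, w.length = wordLength T g ∧ (∀ t ∈ w, t ∈ T) ∧ w.prod = g := by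
  have hne : {k : ℕ | ∃ w : List G, w.length = k ∧ (∀ t ∈ w, t ∈ T) ∧ w.prod = g}.Nonempty := by
    obtain ⟨w, hw, hp⟩ :=
      Submonoid.exists_list_of_mem_closure (s := T) (x := g) (by rw [hT]; trivial)
    exact ⟨w.length, w, rfl, hw, hp⟩
  exact Nat.sInf_mem hne

theorem wordLength_one {G : Type*} [Group G] (T : Set G) : wordLength T 1 = 0 :=
  Nat.le_zero.mp (Nat.sInf_le ⟨[], rfl, by simp, rfl⟩)

theorem wordLength_mul_le {G : Type*} [Group G] {T : Set G} (hT : Submonoid.closure T = ⊤)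
    (g h : G) : wordLength T (g * h) ≤ wordLength T g + wordLength T h := by
  obtain ⟨v, hv, hvT, rfl⟩ := exists_reduced_word hT g
  obtain ⟨w, hw, hwT, rfl⟩ := exists_reduced_word hT h
  refine Nat.sInf_le ⟨v ++ w, by simp [hv, hw], ?_, by simp⟩
  intro t ht
  rcases List.mem_append.mp ht with h | h
  · exact hvT t h
  · exact hwT t h

theorem eq_one_of_wordLength_eq_zero {G : Type*} [Group G] {T : Set G}
    (hT : Submonoid.closure T = ⊤) {g : G} (h : wordLength T g = 0) : g = 1 := by
  obtain ⟨w, hw, -, rfl⟩ := exists_reduced_word hT g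
  rw [h, List.length_eq_zero_iff] at hw
  simp [hw]

/-- The prefix order of a group with respect to a generating set `T`:
`x ≤ y` if and only if `ℓ(y) = ℓ(x) + ℓ(x⁻¹ y)`. -/
@[reducible] noncomputable def prefixOrder {G : Type*} [Group G] (T : Set G)
    (hT : Submonoid.closure T = ⊤) : PartialOrder G where
  le x y := wordLength T y = wordLength T x + wordLength T (x⁻¹ * y)
  le_refl x := by simp [wordLength_one]
  le_trans x y z hxy hyz := by
    have h1 := wordLength_mul_le hT x (x⁻¹ * z)
    have h2 := wordLength_mul_le hT (x⁻¹ * y) (y⁻¹ * z)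
    have e1 : x * (x⁻¹ * z) = z := by group
    have e2 : x⁻¹ * y * (y⁻¹ * z) = x⁻¹ * z := by group
    rw [e1] at h1
    rw [e2] at h2
    omega
  le_antisymm x y hxy hyx := by
    have h : wordLength T (x⁻¹ * y) = 0 := by omega
    exact inv_mul_eq_one.mp (eq_one_of_wordLength_eq_zero hT h)

/-- The set of all transpositions of the symmetric group on `N` letters. -/
def transpositions (N : ℕ) : Set (Perm (Fin N)) := {t | t.IsSwap}

/-- The set of all 3-cycles of the alternating group on `N` letters. -/
def threeCycles (N : ℕ) : Set (alternatingGroup (Fin N)) :=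
  {t | (t : Perm (Fin N)).IsThreeCycle}

theorem closure_transpositions (N : ℕ) : Submonoid.closure (transpositions N) = ⊤ :=
  Perm.mclosure_isSwap

theorem closure_threeCycles (N : ℕ) : Submonoid.closure (threeCycles N) = ⊤ := by
  have hinv : (threeCycles N)⁻¹ = threeCycles N := by
    ext t
    simp [threeCycles, Perm.IsThreeCycle]
  have himg : ((alternatingGroup (Fin N)).subtype '' threeCycles N)
      = {σ : Perm (Fin N) | σ.IsThreeCycle} := by
    ext σ
    constructor
    · rintro ⟨t, ht, rfl⟩
      exact ht
    · intro hσ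
      exact ⟨⟨σ, hσ.mem_alternatingGroup⟩, hσ, rfl⟩
  have hcl : Subgroup.closure (threeCycles N) = ⊤ := by
    apply Subgroup.map_injective (alternatingGroup (Fin N)).subtype_injective
    rw [MonoidHom.map_closure, himg, Perm.closure_three_cycles_eq_alternating,
      ← MonoidHom.range_eq_map, Subgroup.range_subtype]
  have h := Subgroup.closure_toSubmonoid (threeCycles N)
  rw [hinv, Set.union_self, hcl] at h
  rw [← h]
  rfl

/-- The absolute order `≤₂` on the symmetric group. -/
@[reducible] noncomputable def order2 (N : ℕ) : PartialOrder (Perm (Fin N)) :=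
  prefixOrder (transpositions N) (closure_transpositions N)

/-- The order `≤₃` on the alternating group. -/
@[reducible] noncomputable def order3 (N : ℕ) : PartialOrder (alternatingGroup (Fin N)) :=
  prefixOrder (threeCycles N) (closure_threeCycles N)

/-- The interval `[x, y]₂` in the symmetric group with the absolute order. -/
def interval2 {N : ℕ} (x y : Perm (Fin N)) : Set (Perm (Fin N)) :=
  {u | (order2 N).le x u ∧ (order2 N).le u y}

/-- The interval `[x, y]₃` in the alternating group with the order `≤₃`. -/
def interval3 {N : ℕ} (x y : alternatingGroup (Fin N)) : Set (alternatingGroup (Fin N)) :=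
  {u | (order3 N).le x u ∧ (order3 N).le u y}

/-- All cycles of `x` are odd. (The cycle type does not list fixed points, which are odd cycles.) -/
def HasOnlyOddCycles {N : ℕ} (x : Perm (Fin N)) : Prop := ∀ k ∈ x.cycleType, Odd k

/-- The set of noncrossing partitions: the permutations `x ≤₂ c` with `c = (1 2 … N)`. The letters
`1, …, N` are represented by `0, …, N - 1`. -/
def NC (N : ℕ) : Set (Perm (Fin N)) := {x | (order2 N).le x (finRotate N)}

/-- The permutation `σ` is an increasing cycle `(u₁ < u₂ < ⋯ < u_q)` such that `q` is odd and all
differences `u_{j+1} - u_j`, for `1 ≤ j < q`, are odd. -/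
def IsODCycle {N : ℕ} (σ : Perm (Fin N)) : Prop :=
  ∃ u : List (Fin N), u.Pairwise (fun a b => a < b) ∧ u.formPerm = σ ∧ Odd u.length ∧
    u.IsChain (fun a b => Odd (((b : ℕ) : ℤ) - ((a : ℕ) : ℤ)))

/-- The noncrossing partitions all of whose cycles have odd length and odd differences of
neighbours. (Fixed points, that is, cycles with `q = 1`, satisfy this condition trivially.) -/
def ONC (N : ℕ) : Set (Perm (Fin N)) :=
  {x | x ∈ NC N ∧ ∀ σ ∈ x.cycleFactorsFinset, IsODCycle σ}

/-- Along the map `f` (an inclusion, in the applications), the subset `A` with the order of the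
poset `P` is an induced subposet of the subset `B` with the order of the poset `Q`. -/
structure IsInducedSubposet {α β : Type*} (P : PartialOrder α) (Q : PartialOrder β) (f : α → β)
    (A : Set α) (B : Set β) : Prop where
  injOn : Set.InjOn f A
  mapsTo : Set.MapsTo f A B
  le_iff_le : ∀ a ∈ A, ∀ b ∈ A, P.le a b ↔ Q.le (f a) (f b)

section FixedSpace

variable {α : Type*}

/-- The rational functions on `α` which are invariant under the permutation `x`. -/
def fixedSpace (x : Perm α) : Submodule ℚ (α → ℚ) where
  carrier := {f | ∀ i, f (x i) = f i}
  add_mem' hf hg i := by simp [hf i, hg i]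
  zero_mem' i := rfl
  smul_mem' c f hf i := by simp [hf i]

theorem fixedSpace_inf_le (x y : Perm α) : fixedSpace x ⊓ fixedSpace y ≤ fixedSpace (x * y) := by
  rintro f ⟨hx, hy⟩ i
  rw [Perm.mul_apply, hx, hy]

variable [Fintype α]

/-- The codimension of the space of invariant functions. -/
noncomputable def absRank (x : Perm α) : ℕ := Fintype.card α - Module.finrank ℚ (fixedSpace x)

theorem absRank_add_finrank (x : Perm α) :
    absRank x + Module.finrank ℚ (fixedSpace x) = Fintype.card α := by
  have := Submodule.finrank_le (fixedSpace x)
  rw [Module.finrank_fintype_fun_eq_card] at this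
  unfold absRank
  omega

theorem finrank_fixedSpace_inf (x y : Perm α) :
    Fintype.card α ≤ Module.finrank ℚ (fixedSpace x ⊓ fixedSpace y : Submodule ℚ (α → ℚ)) +
      absRank x + absRank y := by
  have h := Submodule.finrank_sup_add_finrank_inf_eq (fixedSpace x) (fixedSpace y)
  have h1 := Submodule.finrank_le (fixedSpace x ⊔ fixedSpace y)
  rw [Module.finrank_fintype_fun_eq_card] at h1
  have := absRank_add_finrank x
  have := absRank_add_finrank y
  omega

theorem absRank_mul_le (x y : Perm α) : absRank (x * y) ≤ absRank x + absRank y := by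
  have h := finrank_fixedSpace_inf x y
  have h1 := Submodule.finrank_mono (fixedSpace_inf_le x y)
  have := absRank_add_finrank (x * y)
  omega

theorem fixedSpace_mul_eq {x y : Perm α} (h : absRank (x * y) = absRank x + absRank y) :
    fixedSpace (x * y) = fixedSpace x ⊓ fixedSpace y := by
  symm
  apply Submodule.eq_of_le_of_finrank_le (fixedSpace_inf_le x y)
  have h := finrank_fixedSpace_inf x y
  have := absRank_add_finrank (x * y)
  omega

theorem sameCycle_mul_of_absRank {x y : Perm α} (h : absRank (x * y) = absRank x + absRank y)
    (i : α) : (x * y).SameCycle i (x i) ∧ (x * y).SameCycle i (y i) := by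
  classical
  let f : α → ℚ := fun j => if (x * y).SameCycle i j then 1 else 0
  have hf : f ∈ fixedSpace (x * y) := by
    intro j
    simp only [f, Perm.sameCycle_apply_right]
  rw [fixedSpace_mul_eq h] at hf
  have hi : f i = 1 := if_pos (Perm.SameCycle.refl _ _)
  constructor
  · by_contra hc
    have := hf.1 i
    rw [hi] at this
    simp [f, hc] at this
  · by_contra hc
    have := hf.2 i
    rw [hi] at this
    simp [f, hc] at this

theorem absRank_mul_comm (x y : Perm α) : absRank (x * y) = absRank (y * x) := by
  have key : ∀ x y : Perm α, Module.finrank ℚ (fixedSpace (x * y)) ≤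
      Module.finrank ℚ (fixedSpace (y * x)) := by
    intro x y
    let e := LinearEquiv.funCongrLeft ℚ ℚ x
    rw [← LinearEquiv.finrank_map_eq e]
    apply Submodule.finrank_mono
    rintro _ ⟨f, hf, rfl⟩ i
    have := hf (x i)
    simpa [e, LinearMap.funLeft_apply] using this
  have := absRank_add_finrank (x * y)
  have := absRank_add_finrank (y * x)
  have := key x y
  have := key y x
  omega

@[simp] theorem absRank_one : absRank (1 : Perm α) = 0 := by
  have : fixedSpace (1 : Perm α) = ⊤ := by
    rw [eq_top_iff]
    intro f _ i
    rfl
  have h := absRank_add_finrank (1 : Perm α)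
  rw [this, finrank_top, Module.finrank_fintype_fun_eq_card] at h
  omega

variable [DecidableEq α]

theorem absRank_swap_le (i j : α) : absRank (swap i j) ≤ 1 := by
  let φ : (α → ℚ) →ₗ[ℚ] ℚ := LinearMap.proj (R := ℚ) (φ := fun _ : α => ℚ) i - LinearMap.proj j
  have h : LinearMap.ker φ ≤ fixedSpace (swap i j) := by
    intro f hf k
    have hf : f i = f j := by simpa [φ, sub_eq_zero] using hf
    rw [swap_apply_def]
    split_ifs with h1 h2
    · rw [h1, hf]
    · rw [h2, hf]
    · rfl
  have h1 := Submodule.finrank_mono h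
  have h2 := LinearMap.finrank_range_add_finrank_ker φ
  have h3 := Submodule.finrank_le (LinearMap.range φ)
  rw [Module.finrank_fintype_fun_eq_card] at h2
  rw [Module.finrank_self] at h3
  have := absRank_add_finrank (swap i j)
  omega

theorem absRank_swap_mul_lt (x : Perm α) (i : α) (hi : x i ≠ i) :
    absRank (swap i (x i) * x) + 1 ≤ absRank x := by
  have h : fixedSpace x < fixedSpace (swap i (x i) * x) := by
    refine lt_of_le_of_ne ?_ ?_
    · intro f hf k
      rw [Perm.mul_apply, swap_apply_def]
      split_ifs with h1 h2
      · rw [hf, ← hf k, h1]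
      · rw [← hf k, h2, hf]
      · exact hf k
    · intro he
      have : (Pi.single i 1 : α → ℚ) ∈ fixedSpace (swap i (x i) * x) := by
        intro k
        by_cases hk : k = i
        · subst hk
          simp
        · rw [Pi.single_eq_of_ne hk, Pi.single_eq_of_ne]
          intro h
          apply hk
          apply (swap i (x i) * x).injective
          rw [h]
          simp
      rw [← he] at this
      have := this i
      simp [hi] at this
  have h1 := Submodule.finrank_lt_finrank_of_lt h
  have := absRank_add_finrank x
  have := absRank_add_finrank (swap i (x i) * x)
  omega

theorem exists_swap_list (x : Perm α) :
    ∃ l : List (Perm α), (∀ t ∈ l, t.IsSwap) ∧ l.prod = x ∧ l.length ≤ absRank x := by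
  induction h : absRank x using Nat.strong_induction_on generalizing x with
  | _ n ih =>
    by_cases hx : ∃ i, x i ≠ i
    · obtain ⟨i, hi⟩ := hx
      have h1 := absRank_swap_mul_lt x i hi
      obtain ⟨l, hl, hp, hn⟩ := ih _ (by omega) (swap i (x i) * x) rfl
      refine ⟨swap i (x i) :: l, ?_, ?_, ?_⟩
      · intro t ht
        rcases List.mem_cons.mp ht with rfl | ht
        · exact ⟨i, x i, hi.symm, rfl⟩
        · exact hl t ht
      · simp [hp]
      · rw [List.length_cons]
        omega
    · push Not at hx
      exact ⟨[], by simp, by ext i; simp [hx], by simp⟩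

end FixedSpace

theorem absRank_le_of_list {α : Type*} [Fintype α] [DecidableEq α] (n : ℕ) (l : List (Perm α))
    (h : ∀ t ∈ l, absRank t ≤ n) : absRank l.prod ≤ n * l.length := by
  induction l with
  | nil => simp
  | cons t l ih =>
    have h1 := absRank_mul_le t l.prod
    have h2 := ih fun s hs => h s (List.mem_cons_of_mem _ hs)
    have h3 := h t List.mem_cons_self
    rw [List.prod_cons, List.length_cons, mul_add]
    omega

theorem wordLength_le {G : Type*} [Group G] {T : Set G} (l : List G) (h : ∀ t ∈ l, t ∈ T) :
    wordLength T l.prod ≤ l.length :=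
  Nat.sInf_le ⟨l, rfl, h, rfl⟩

theorem wordLength_transpositions {N : ℕ} (x : Perm (Fin N)) :
    wordLength (transpositions N) x = absRank x := by
  apply le_antisymm
  · obtain ⟨l, hl, rfl, hn⟩ := exists_swap_list x
    exact (wordLength_le l hl).trans hn
  · obtain ⟨l, hl, hT, rfl⟩ := exists_reduced_word (closure_transpositions N) x
    rw [← hl]
    refine (absRank_le_of_list 1 l fun t ht => ?_).trans (one_mul _).le
    obtain ⟨i, j, -, rfl⟩ := hT t ht
    exact absRank_swap_le i j

section Periods

variable {α : Type*}

/-- The length of the cycle of `x` through `i`. -/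
noncomputable def cycleLength (x : Perm α) (i : α) : ℕ := Function.minimalPeriod x i

theorem cycleLength_dvd_iff (x : Perm α) (i : α) (n : ℕ) :
    cycleLength x i ∣ n ↔ (x ^ n) i = i := by
  rw [cycleLength, ← Function.isPeriodicPt_iff_minimalPeriod_dvd, Function.IsPeriodicPt,
    Perm.iterate_eq_pow]
  rfl

theorem sameCycle_pow (x : Perm α) (i : α) (n : ℕ) : x.SameCycle i ((x ^ n) i) :=
  ⟨n, by rw [zpow_natCast]⟩

theorem cycleLength_pos [Finite α] (x : Perm α) (i : α) : 0 < cycleLength x i := by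
  apply Function.IsPeriodicPt.minimalPeriod_pos (n := orderOf x) (orderOf_pos x)
  rw [Function.IsPeriodicPt, Perm.iterate_eq_pow, pow_orderOf_eq_one]
  rfl

theorem pow_cycleLength_apply (x : Perm α) (i : α) : (x ^ cycleLength x i) i = i :=
  (cycleLength_dvd_iff x i _).mp dvd_rfl

theorem pow_apply_eq_pow_apply_iff (x : Perm α) (i : α) (m n : ℕ) :
    (x ^ m) i = (x ^ n) i ↔ m ≡ n [MOD cycleLength x i] := by
  wlog h : m ≤ n generalizing m n
  · rw [eq_comm, this n m (by omega), Nat.ModEq.comm]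
  obtain ⟨k, rfl⟩ := Nat.exists_eq_add_of_le h
  rw [pow_add, Perm.mul_apply, (x ^ m).injective.eq_iff, eq_comm, ← cycleLength_dvd_iff,
    Nat.modEq_iff_dvd' h, Nat.add_sub_cancel_left]

theorem cycleLength_eq_of_sameCycle {x : Perm α} {i j : α} (h : x.SameCycle i j) :
    cycleLength x i = cycleLength x j := by
  obtain ⟨n, rfl⟩ := h
  have : ∀ k, (x ^ k) ((x ^ n) i) = (x ^ n) i ↔ (x ^ k) i = i := by
    intro k
    rw [← Perm.mul_apply, ← zpow_natCast, ← zpow_add, add_comm, zpow_add, Perm.mul_apply,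
      (x ^ n).injective.eq_iff]
  apply Nat.dvd_antisymm
  · rw [cycleLength_dvd_iff, ← this, pow_cycleLength_apply]
  · rw [cycleLength_dvd_iff, this, pow_cycleLength_apply]

theorem exists_pow_of_sameCycle [Finite α] {x : Perm α} {i j : α} (h : x.SameCycle i j) :
    ∃ d, 1 ≤ d ∧ d ≤ cycleLength x i ∧ (x ^ d) i = j := by
  obtain ⟨n, -, -, rfl⟩ := h.exists_pow_eq''
  have hL := cycleLength_pos x i
  by_cases h0 : n % cycleLength x i = 0
  · refine ⟨cycleLength x i, hL, le_rfl, ?_⟩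
    rw [pow_cycleLength_apply, eq_comm, ← cycleLength_dvd_iff]
    exact Nat.dvd_of_mod_eq_zero h0
  · exact ⟨n % cycleLength x i, Nat.pos_of_ne_zero h0, (Nat.mod_lt _ hL).le,
      (pow_apply_eq_pow_apply_iff x i _ _).mpr (Nat.mod_modEq _ _)⟩

theorem eq_of_pow_apply_eq {x : Perm α} {i : α} {m n : ℕ} (hm : 1 ≤ m)
    (hm' : m ≤ cycleLength x i) (hn : 1 ≤ n) (hn' : n ≤ cycleLength x i)
    (h : (x ^ m) i = (x ^ n) i) : m = n := by
  rw [pow_apply_eq_pow_apply_iff] at h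
  wlog hmn : m ≤ n generalizing m n
  · exact (this hn hn' hm hm' h.symm (by omega)).symm
  rw [Nat.modEq_iff_dvd' hmn] at h
  have := Nat.eq_zero_of_dvd_of_lt h (by omega)
  omega

/-- All cycles of `x`, the fixed points included, have odd length. -/
def OddCycles (x : Perm α) : Prop := ∀ i, Odd (cycleLength x i)

theorem oddCycles_of_exists {x : Perm α} (h : ∀ i, ∃ n, Odd n ∧ (x ^ n) i = i) : OddCycles x := by
  intro i
  obtain ⟨n, hn, hx⟩ := h i
  exact hn.of_dvd_nat ((cycleLength_dvd_iff x i n).mpr hx)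

theorem OddCycles.conj {x : Perm α} (h : OddCycles x) (g : Perm α) :
    OddCycles (g * x * g⁻¹) := by
  apply oddCycles_of_exists
  intro i
  refine ⟨_, h (g⁻¹ i), ?_⟩
  rw [conj_pow, Perm.mul_apply, Perm.mul_apply, pow_cycleLength_apply]
  simp

end Periods

section Averages

variable {α : Type*}

theorem sum_range_mul_cycleLength (u : Perm α) (g : α → ℚ) (i : α) (m : ℕ) :
    ∑ s ∈ Finset.range (cycleLength u i * m), g ((u ^ s) i) =
      m * ∑ s ∈ Finset.range (cycleLength u i), g ((u ^ s) i) := by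
  induction m with
  | zero => simp
  | succ m ih =>
    rw [mul_add, mul_one, Finset.sum_range_add, ih, Nat.cast_succ, add_mul, one_mul]
    congr 1
    apply Finset.sum_congr rfl
    intro s _
    rw [add_comm, pow_add, Perm.mul_apply,
      (cycleLength_dvd_iff u i (cycleLength u i * m)).mp (dvd_mul_right _ _)]

variable [Fintype α]

theorem sum_eq_sum_cycle_average (u : Perm α) (g : α → ℚ) :
    ∑ i, g i = ∑ i, (∑ s ∈ Finset.range (cycleLength u i), g ((u ^ s) i)) / cycleLength u i := by
  have hn : (0 : ℚ) < orderOf u := by exact_mod_cast orderOf_pos u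
  have h1 : ∑ i, ∑ s ∈ Finset.range (orderOf u), g ((u ^ s) i) = orderOf u * ∑ i, g i := by
    rw [Finset.sum_comm]
    simp [Equiv.sum_comp (u ^ _) g]
  have h2 : ∀ i, ∑ s ∈ Finset.range (orderOf u), g ((u ^ s) i) =
      orderOf u * ((∑ s ∈ Finset.range (cycleLength u i), g ((u ^ s) i)) / cycleLength u i) := by
    intro i
    obtain ⟨m, hm⟩ : cycleLength u i ∣ orderOf u :=
      (cycleLength_dvd_iff u i _).mpr (by simp [pow_orderOf_eq_one])
    have : (0 : ℚ) < cycleLength u i := by exact_mod_cast cycleLength_pos u i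
    rw [hm, sum_range_mul_cycleLength]
    push_cast
    field_simp
  rw [Finset.sum_congr rfl fun i _ => h2 i, ← Finset.mul_sum] at h1
  exact (mul_left_cancel₀ hn.ne' h1).symm

theorem card_sameCycle (x : Perm α) (i : α) [DecidablePred (x.SameCycle i)] :
    (Finset.univ.filter (x.SameCycle i)).card = cycleLength x i := by
  classical
  have : Finset.univ.filter (x.SameCycle i) =
      (Finset.Icc 1 (cycleLength x i)).image fun s => (x ^ s) i := by
    ext j
    simp only [Finset.mem_filter, Finset.mem_univ, true_and, Finset.mem_image, Finset.mem_Icc]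
    constructor
    · intro h
      obtain ⟨d, h1, h2, h3⟩ := exists_pow_of_sameCycle h
      exact ⟨d, ⟨h1, h2⟩, h3⟩
    · rintro ⟨d, -, rfl⟩
      exact sameCycle_pow x i d
  rw [this, Finset.card_image_of_injOn, Nat.card_Icc, Nat.add_sub_cancel]
  intro m hm n hn h
  rw [Finset.coe_Icc, Set.mem_Icc] at hm hn
  exact eq_of_pow_apply_eq hm.1 hm.2 hn.1 hn.2 h

/-- Invariant functions are functions on the set of cycles. -/
noncomputable def fixedSpaceEquiv (x : Perm α) :
    fixedSpace x ≃ₗ[ℚ] (Quotient (Perm.SameCycle.setoid x) → ℚ) where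
  toFun f := Quotient.lift f.1 (by
    rintro i j h
    obtain ⟨n, -, -, rfl⟩ := Perm.SameCycle.exists_pow_eq'' h
    clear h
    induction n with
    | zero => rfl
    | succ n ih => rw [pow_succ', Perm.mul_apply, f.2, ih])
  invFun g := ⟨fun i => g (Quotient.mk _ i), fun i => congrArg g (Quotient.sound (by
    exact Perm.sameCycle_apply_left.mpr (Perm.SameCycle.refl x i)))⟩
  left_inv f := rfl
  right_inv g := by
    ext q
    induction q using Quotient.inductionOn
    rfl
  map_add' f g := by
    ext q
    induction q using Quotient.inductionOn
    rfl
  map_smul' c f := by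
    ext q
    induction q using Quotient.inductionOn
    rfl

theorem finrank_fixedSpace (x : Perm α) :
    (Module.finrank ℚ (fixedSpace x) : ℚ) = ∑ i, 1 / (cycleLength x i : ℚ) := by
  classical
  have : Fintype (Quotient (Perm.SameCycle.setoid x)) := Fintype.ofFinite _
  rw [(fixedSpaceEquiv x).finrank_eq, Module.finrank_fintype_fun_eq_card,
    ← Finset.sum_fiberwise Finset.univ (Quotient.mk (Perm.SameCycle.setoid x))]
  rw [Finset.sum_congr rfl (g := fun _ => (1 : ℚ))]
  · simp
  intro q _
  induction q using Quotient.inductionOn with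
  | h i =>
    have h : Finset.univ.filter (fun j => Quotient.mk (Perm.SameCycle.setoid x) j = ⟦i⟧) =
        Finset.univ.filter (x.SameCycle i) := by
      ext j
      simp only [Finset.mem_filter, Finset.mem_univ, true_and]
      rw [Quotient.eq]
      exact Perm.sameCycle_comm
    rw [h, Finset.sum_congr rfl (g := fun _ => 1 / (cycleLength x i : ℚ)), Finset.sum_const,
      card_sameCycle]
    · have : (0 : ℚ) < cycleLength x i := by exact_mod_cast cycleLength_pos x i
      rw [nsmul_eq_mul]
      field_simp
    · intro j hj
      rw [cycleLength_eq_of_sameCycle (Finset.mem_filter.mp hj).2]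

theorem absRank_eq_card_sub (x : Perm α) :
    (absRank x : ℚ) = Fintype.card α - ∑ i, 1 / (cycleLength x i : ℚ) := by
  rw [← finrank_fixedSpace, ← absRank_add_finrank x]
  push_cast
  ring

end Averages

section Displacement

variable {α : Type*}

/-- The least positive number of steps along `w` which lead from `i` to `u i`. -/
noncomputable def disp (w u : Perm α) (i : α) : ℕ := sInf {d | 1 ≤ d ∧ (w ^ d) i = u i}

/-- Every cycle of `u` is contained in a cycle of `w`. -/
def Refines (u w : Perm α) : Prop := ∀ i, w.SameCycle i (u i)

theorem Refines.pow {u w : Perm α} (h : Refines u w) (n : ℕ) : Refines (u ^ n) w := by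
  intro i
  induction n with
  | zero => exact Perm.SameCycle.refl _ _
  | succ n ih =>
    rw [pow_succ', Perm.mul_apply]
    exact ih.trans (h _)

variable [Finite α]

theorem one_le_disp {w u : Perm α} {i : α} (h : w.SameCycle i (u i)) : 1 ≤ disp w u i := by
  obtain ⟨d, h1, -, h2⟩ := exists_pow_of_sameCycle h
  exact (Nat.sInf_mem (s := {d | 1 ≤ d ∧ (w ^ d) i = u i}) ⟨d, h1, h2⟩).1

theorem pow_disp_apply {w u : Perm α} {i : α} (h : w.SameCycle i (u i)) :
    (w ^ disp w u i) i = u i := by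
  obtain ⟨d, h1, -, h2⟩ := exists_pow_of_sameCycle h
  exact (Nat.sInf_mem (s := {d | 1 ≤ d ∧ (w ^ d) i = u i}) ⟨d, h1, h2⟩).2

theorem disp_le_cycleLength {w u : Perm α} {i : α} (h : w.SameCycle i (u i)) :
    disp w u i ≤ cycleLength w i := by
  obtain ⟨d, h1, h2, h3⟩ := exists_pow_of_sameCycle h
  exact (Nat.sInf_le (show d ∈ {d | 1 ≤ d ∧ (w ^ d) i = u i} from ⟨h1, h3⟩)).trans h2

theorem disp_eq {w u : Perm α} {i : α} {d : ℕ} (h1 : 1 ≤ d) (h2 : d ≤ cycleLength w i)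
    (h : (w ^ d) i = u i) : disp w u i = d := by
  have hs : w.SameCycle i (u i) := h ▸ sameCycle_pow w i d
  exact eq_of_pow_apply_eq (one_le_disp hs) (disp_le_cycleLength hs) h1 h2
    ((pow_disp_apply hs).trans h.symm)

theorem disp_one (w : Perm α) (i : α) : disp w 1 i = cycleLength w i :=
  disp_eq (cycleLength_pos w i) le_rfl (pow_cycleLength_apply w i)

theorem disp_self (w : Perm α) (i : α) : disp w w i = 1 :=
  disp_eq le_rfl (cycleLength_pos w i) (by rw [pow_one])

theorem pow_sum_disp_apply {w v : Perm α} (h : Refines v w) (i : α) (n : ℕ) :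
    (w ^ ∑ s ∈ Finset.range n, disp w v ((v ^ s) i)) i = (v ^ n) i := by
  induction n with
  | zero => rfl
  | succ n ih =>
    rw [Finset.sum_range_succ, add_comm, pow_add, Perm.mul_apply, ih, pow_disp_apply (h _),
      pow_succ', Perm.mul_apply]

theorem sum_disp_pos {w v : Perm α} (h : Refines v w) (i : α) {n : ℕ} (hn : 0 < n) :
    1 ≤ ∑ s ∈ Finset.range n, disp w v ((v ^ s) i) :=
  (one_le_disp (h _)).trans
    (Finset.single_le_sum (f := fun s => disp w v ((v ^ s) i)) (fun _ _ => Nat.zero_le _)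
      (Finset.mem_range.mpr hn))

theorem cycleLength_le_sum_disp {w v : Perm α} (h : Refines v w) (i : α) :
    cycleLength w i ≤ ∑ s ∈ Finset.range (cycleLength v i), disp w v ((v ^ s) i) := by
  apply Nat.le_of_dvd (sum_disp_pos h i (cycleLength_pos v i))
  rw [cycleLength_dvd_iff, pow_sum_disp_apply h, pow_cycleLength_apply]

theorem disp_complement {u v : Perm α} (hu : Refines u v) (j : α) :
    disp v u j + disp v (v * u⁻¹) (u j) = cycleLength v j + 1 := by
  have hL := cycleLength_eq_of_sameCycle (hu j)
  have h1 := one_le_disp (hu j)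
  have h2 := disp_le_cycleLength (hu j)
  have h5 : disp v (v * u⁻¹) (u j) = cycleLength v j + 1 - disp v u j := by
    apply disp_eq
    · omega
    · omega
    · rw [Perm.mul_apply, show u⁻¹ (u j) = j from u.symm_apply_apply j]
      nth_rewrite 1 [← pow_disp_apply (hu j)]
      rw [← Perm.mul_apply, ← pow_add, Nat.sub_add_cancel (by omega), pow_succ',
        Perm.mul_apply, pow_cycleLength_apply]
  omega

end Displacement

section Winding

variable {α : Type*} [Fintype α]

/-- The relation `u ≤ v` in the absolute order. -/
def Below (u v : Perm α) : Prop := absRank v = absRank (v * u⁻¹) + absRank u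

theorem Below.refines {u v : Perm α} (h : Below u v) : Refines u v := by
  intro i
  have := (sameCycle_mul_of_absRank (x := v * u⁻¹) (y := u) (by rw [inv_mul_cancel_right]; exact h) i).2
  simpa using this

theorem Below.refines_complement {u v : Perm α} (h : Below u v) : Refines (v * u⁻¹) v := by
  intro i
  have := (sameCycle_mul_of_absRank (x := v * u⁻¹) (y := u) (by rw [inv_mul_cancel_right]; exact h) i).1
  simpa using this

theorem Below.complement {u v : Perm α} (h : Below u v) : Below (v * u⁻¹) v := by
  have : absRank (v * (v * u⁻¹)⁻¹) = absRank u := by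
    rw [mul_inv_rev, inv_inv, ← mul_assoc, absRank_mul_comm]
    simp
  rw [Below, this, add_comm]
  exact h

theorem below_iff {u v : Perm α} : Below u v ↔ absRank v = absRank u + absRank (u⁻¹ * v) := by
  rw [Below, absRank_mul_comm, add_comm]

theorem Below.refl (u : Perm α) : Below u u := by simp [Below]

theorem one_below (u : Perm α) : Below 1 u := by simp [Below]

theorem Below.trans {u v w : Perm α} (h : Below u v) (h' : Below v w) : Below u w := by
  rw [below_iff] at *
  have h1 := absRank_mul_le u (u⁻¹ * w)
  have h2 := absRank_mul_le (u⁻¹ * v) (v⁻¹ * w)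
  rw [mul_inv_cancel_left] at h1
  rw [mul_assoc, mul_inv_cancel_left] at h2
  omega

theorem sum_disp_div (v u : Perm α) (h : Refines u v) :
    ∑ i, (disp v u i : ℚ) / cycleLength v i =
      ∑ i, ((∑ s ∈ Finset.range (cycleLength u i), disp v u ((u ^ s) i) : ℕ) : ℚ) /
        cycleLength v i / cycleLength u i := by
  rw [sum_eq_sum_cycle_average u]
  apply Finset.sum_congr rfl
  intro i _
  congr 1
  rw [Nat.cast_sum, Finset.sum_div]
  apply Finset.sum_congr rfl
  intro s _
  rw [cycleLength_eq_of_sameCycle (h.pow s i)]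

theorem cycle_weight_le (v u : Perm α) (h : Refines u v) (i : α) :
    1 / (cycleLength u i : ℚ) ≤
      ((∑ s ∈ Finset.range (cycleLength u i), disp v u ((u ^ s) i) : ℕ) : ℚ) /
        cycleLength v i / cycleLength u i := by
  have hv : (0 : ℚ) < cycleLength v i := by exact_mod_cast cycleLength_pos v i
  apply div_le_div_of_nonneg_right _ (Nat.cast_nonneg _)
  rw [le_div_iff₀ hv, one_mul]
  exact_mod_cast cycleLength_le_sum_disp h i

/-- Below `v`, every cycle of `u` winds around its cycle of `v` exactly once. -/
theorem Below.sum_disp {u v : Perm α} (h : Below u v) (i : α) :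
    ∑ s ∈ Finset.range (cycleLength u i), disp v u ((u ^ s) i) = cycleLength v i := by
  have hu := h.refines
  have hk := h.refines_complement
  have h1 : ∑ i, (disp v u i : ℚ) / cycleLength v i +
      ∑ i, (disp v (v * u⁻¹) i : ℚ) / cycleLength v i =
      Fintype.card α + ∑ i, 1 / (cycleLength v i : ℚ) := by
    rw [← Equiv.sum_comp u (fun i => (disp v (v * u⁻¹) i : ℚ) / cycleLength v i),
      ← Finset.sum_add_distrib]
    have : (Fintype.card α : ℚ) = ∑ _i : α, 1 := by simp
    rw [this, ← Finset.sum_add_distrib]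
    apply Finset.sum_congr rfl
    intro j _
    have hL : (0 : ℚ) < cycleLength v j := by exact_mod_cast cycleLength_pos v j
    rw [← cycleLength_eq_of_sameCycle (hu j), ← add_div, ← Nat.cast_add,
      disp_complement hu]
    push_cast
    field_simp
  have h2 : ∑ i, 1 / (cycleLength u i : ℚ) + ∑ i, 1 / (cycleLength (v * u⁻¹) i : ℚ) =
      Fintype.card α + ∑ i, 1 / (cycleLength v i : ℚ) := by
    have h3 : (absRank v : ℚ) = absRank (v * u⁻¹) + absRank u := by exact_mod_cast h
    rw [absRank_eq_card_sub, absRank_eq_card_sub, absRank_eq_card_sub] at h3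
    linarith
  rw [sum_disp_div v u hu, sum_disp_div v _ hk] at h1
  have h4 := Finset.sum_le_sum fun i (_ : i ∈ Finset.univ) => cycle_weight_le v u hu i
  have h5 := Finset.sum_le_sum fun i (_ : i ∈ Finset.univ) => cycle_weight_le v _ hk i
  have h6 := (Finset.sum_eq_sum_iff_of_le
    fun i (_ : i ∈ Finset.univ) => cycle_weight_le v u hu i).mp (by linarith) i (Finset.mem_univ i)
  have hu' : (0 : ℚ) < cycleLength u i := by exact_mod_cast cycleLength_pos u i
  have hv' : (0 : ℚ) < cycleLength v i := by exact_mod_cast cycleLength_pos v i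
  field_simp at h6
  exact_mod_cast h6.symm

theorem Below.disp_chain {u v w : Perm α} (hvw : Below v w) (huv : Refines u v) (i : α) :
    disp w u i = ∑ s ∈ Finset.range (disp v u i), disp w v ((v ^ s) i) := by
  apply disp_eq
  · exact sum_disp_pos hvw.refines i (one_le_disp (huv i))
  · rw [← hvw.sum_disp i]
    exact Finset.sum_le_sum_of_subset (Finset.range_mono (disp_le_cycleLength (huv i)))
  · rw [pow_sum_disp_apply hvw.refines, pow_disp_apply (huv i)]

/-- All displacements of `u` along `v` are odd. -/
def OddDisp (u v : Perm α) : Prop := ∀ i, Odd (disp v u i)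

theorem OddDisp.odd_disp_iff {u v w : Perm α} (hvw : Below v w) (huv : Refines u v)
    (h : OddDisp v w) (i : α) : Odd (disp w u i) ↔ Odd (disp v u i) := by
  rw [hvw.disp_chain huv, Finset.odd_sum_iff_odd_card_odd]
  simp [h _]

theorem OddDisp.trans {u v w : Perm α} (hvw : Below v w) (huv : Refines u v)
    (h : OddDisp v w) (h' : OddDisp u v) : OddDisp u w :=
  fun i => (h.odd_disp_iff hvw huv i).mpr (h' i)

theorem OddDisp.of_below {u v w : Perm α} (hvw : Below v w) (huv : Refines u v)
    (h : OddDisp v w) (h' : OddDisp u w) : OddDisp u v :=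
  fun i => (h.odd_disp_iff hvw huv i).mp (h' i)

theorem oddDisp_one_iff {v : Perm α} : OddDisp 1 v ↔ OddCycles v := by
  simp only [OddDisp, disp_one, OddCycles]

theorem OddDisp.oddCycles {u v : Perm α} (huv : Below u v) (h : OddDisp u v) (hv : OddCycles v) :
    OddCycles u :=
  oddDisp_one_iff.mp (h.of_below huv (one_below u).refines (oddDisp_one_iff.mpr hv))

theorem OddDisp.complement {u v : Perm α} (huv : Below u v) (h : OddDisp u v) (hv : OddCycles v) :
    OddDisp (v * u⁻¹) v := by
  intro i
  obtain ⟨j, rfl⟩ := u.surjective i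
  have h1 := disp_complement huv.refines j
  have h2 := h j
  have h3 := hv j
  have h4 := one_le_disp (huv.refines j)
  rw [Nat.odd_iff] at *
  omega

/-- The displacement of `u` at `i` skips no element of the cycle of `u` through `i`. -/
theorem Below.not_sameCycle_of_lt_disp {u v : Perm α} (h : Below u v) {i : α} {s : ℕ}
    (hs : 0 < s) (hs' : s < disp v u i) : ¬ u.SameCycle i ((v ^ s) i) := by
  intro hc
  obtain ⟨r, hr1, hr2, hr⟩ := exists_pow_of_sameCycle hc
  have hd := disp_le_cycleLength (h.refines i)
  rw [← pow_sum_disp_apply h.refines] at hr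
  have h1 := eq_of_pow_apply_eq (sum_disp_pos h.refines i hr1) (by
    rw [← h.sum_disp i]
    exact Finset.sum_le_sum_of_subset (Finset.range_mono hr2)) hs (by omega) hr
  have h2 := Finset.single_le_sum (f := fun s => disp v u ((u ^ s) i))
    (fun _ _ => Nat.zero_le _) (Finset.mem_range.mpr hr1)
  simp only [pow_zero, Perm.one_apply] at h2
  omega

end Winding

section ThreeCycles

variable {α : Type*}

theorem eq_zero_of_oddCycles {x : Perm α} (hx : OddCycles x) (f : α → ℚ)
    (hf : ∀ i, f (x i) = -f i) : f = 0 := by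
  ext i
  have h : ∀ n : ℕ, f ((x ^ n) i) = (-1) ^ n * f i := by
    intro n
    induction n with
    | zero => simp
    | succ n ih =>
      rw [pow_succ', Perm.mul_apply, hf, ih]
      ring
  have h1 := h (cycleLength x i)
  rw [pow_cycleLength_apply, (hx i).neg_one_pow] at h1
  simp only [Pi.zero_apply]
  linarith

variable [Fintype α]

theorem pow_complement_apply {t x : Perm α} (ht : t.IsCycle) (h : Below t x) {a : α}
    (ha : t a ≠ a) {s : ℕ} (hs : 1 ≤ s) (hs' : s ≤ disp x t a) :
    ((x * t⁻¹) ^ s) (t a) = (x ^ s) a := by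
  induction s, hs using Nat.le_induction with
  | base => simp
  | succ s hs ih =>
    have hfix : t ((x ^ s) a) = (x ^ s) a := by
      by_contra hne
      exact h.not_sameCycle_of_lt_disp hs hs' (ht.sameCycle ha hne)
    rw [pow_succ', Perm.mul_apply, ih (by omega), Perm.mul_apply, pow_succ', Perm.mul_apply]
    congr 1
    exact Perm.inv_eq_iff_eq.mpr hfix.symm

theorem cycleLength_complement {t x : Perm α} (ht : t.IsCycle) (h : Below t x) {a : α}
    (ha : t a ≠ a) : cycleLength (x * t⁻¹) (t a) = disp x t a := by
  have h1 := one_le_disp (h.refines a)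
  have hp := cycleLength_pos (x * t⁻¹) (t a)
  have hle : cycleLength (x * t⁻¹) (t a) ≤ disp x t a := by
    apply Nat.le_of_dvd h1
    rw [cycleLength_dvd_iff, pow_complement_apply ht h ha h1 le_rfl, pow_disp_apply (h.refines a)]
  apply le_antisymm hle
  apply Nat.sInf_le
  refine ⟨hp, ?_⟩
  rw [← pow_complement_apply ht h ha hp hle, pow_cycleLength_apply]

theorem oddCycles_and_oddDisp_of_isThreeCycle [DecidableEq α] {t x : Perm α}
    (ht : t.IsThreeCycle) (h : Below t x) (hp : OddCycles (x * t⁻¹)) :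
    OddCycles x ∧ OddDisp t x := by
  have hd : ∀ a, t a ≠ a → Odd (disp x t a) := by
    intro a ha
    rw [← cycleLength_complement ht.isCycle h ha]
    exact hp _
  have hL : ∀ a, t a ≠ a → Odd (cycleLength x a) := by
    intro a ha
    have h3 : cycleLength t a = 3 := by
      have : cycleLength t a ∣ 3 := by
        rw [cycleLength_dvd_iff, ← ht.orderOf, pow_orderOf_eq_one]
        rfl
      rcases (Nat.dvd_prime Nat.prime_three).mp this with h1 | h1
      · exact absurd (by simpa [h1] using pow_cycleLength_apply t a) ha
      · exact h1
    rw [← h.sum_disp a, h3, Finset.odd_sum_iff_odd_card_odd, Finset.filter_true_of_mem]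
    · decide
    · intro s _
      apply hd
      rwa [← Perm.mul_apply, ← pow_succ', pow_succ, Perm.mul_apply, (t ^ s).injective.ne_iff]
  have hx : OddCycles x := by
    intro i
    by_cases hi : ∃ a, t a ≠ a ∧ x.SameCycle a i
    · obtain ⟨a, ha, hai⟩ := hi
      rw [← cycleLength_eq_of_sameCycle hai]
      exact hL a ha
    · push Not at hi
      have hs : ∀ s : ℕ, ((x * t⁻¹) ^ s) i = (x ^ s) i := by
        intro s
        induction s with
        | zero => rfl
        | succ s ih =>
          have hfix : t ((x ^ s) i) = (x ^ s) i := by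
            by_contra hne
            exact hi _ hne (sameCycle_pow x i s).symm
          rw [pow_succ', Perm.mul_apply, ih, Perm.mul_apply, pow_succ', Perm.mul_apply]
          congr 1
          exact Perm.inv_eq_iff_eq.mpr hfix.symm
      apply (hp i).of_dvd_nat
      rw [cycleLength_dvd_iff, ← hs, pow_cycleLength_apply]
  refine ⟨hx, fun a => ?_⟩
  by_cases ha : t a = a
  · rw [disp_eq (cycleLength_pos x a) le_rfl (by rw [pow_cycleLength_apply, ha])]
    exact hx a
  · exact hd a ha

theorem absRank_le_of_isThreeCycle [DecidableEq α] {t : Perm α} (ht : t.IsThreeCycle) :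
    absRank t ≤ 2 := by
  obtain ⟨a, ha, -⟩ := ht.isCycle
  rw [ht.eq_swap_mul_swap_iff_mem_support.mpr (Perm.mem_support.mpr ha)]
  have h1 := absRank_mul_le (swap a (t a)) (swap (t a) (t (t a)))
  have h2 := absRank_swap_le a (t a)
  have h3 := absRank_swap_le (t a) (t (t a))
  omega

theorem oddCycles_and_oddDisp_of_list [DecidableEq α] (l : List (Perm α))
    (hl : ∀ t ∈ l, t.IsThreeCycle) (p : Perm α) (hp : OddCycles p)
    (h : absRank (p * l.prod) = absRank p + 2 * l.length) :
    OddCycles (p * l.prod) ∧ Below p (p * l.prod) ∧ OddDisp p (p * l.prod) := by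
  induction l generalizing p with
  | nil =>
    rw [List.prod_nil, mul_one]
    exact ⟨hp, Below.refl p, fun i => by rw [disp_self]; exact odd_one⟩
  | cons t l ih =>
    have ht := hl t List.mem_cons_self
    have hl' := fun s hs => hl s (List.mem_cons_of_mem t hs)
    rw [List.prod_cons, List.length_cons, ← mul_assoc] at *
    have h1 := absRank_mul_le (p * t) l.prod
    have h2 := absRank_le_of_list 2 l fun s hs => absRank_le_of_isThreeCycle (hl' s hs)
    have h3 := absRank_mul_le p t
    have h4 := absRank_le_of_isThreeCycle ht
    have hb : Below t (p * t) := by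
      rw [Below, mul_inv_cancel_right]
      omega
    obtain ⟨ho, hd⟩ := oddCycles_and_oddDisp_of_isThreeCycle ht hb (by rwa [mul_inv_cancel_right])
    have hb' := hb.complement
    have hd' := hd.complement hb ho
    rw [mul_inv_cancel_right] at hb' hd'
    obtain ⟨h5, h6, h7⟩ := ih hl' (p * t) ho (by omega)
    exact ⟨h5, hb'.trans h6, h7.trans h6 hb'.refines hd'⟩

/-- A permutation without eigenvalue `-1` is a product of 3-cycles, as short as possible. -/
theorem exists_threeCycle_list [DecidableEq α] (x : Perm α)
    (hx : ∀ f : α → ℚ, (∀ i, f (x i) = -f i) → f = 0) :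
    ∃ l : List (Perm α), (∀ t ∈ l, t.IsThreeCycle) ∧ l.prod = x ∧ 2 * l.length ≤ absRank x := by
  induction h : absRank x using Nat.strong_induction_on generalizing x with
  | _ n ih =>
    by_cases hne : ∃ i, x i ≠ i
    · obtain ⟨i, hi⟩ := hne
      obtain ⟨j, hj⟩ : ∃ j, j = x i := ⟨_, rfl⟩
      obtain ⟨k, hk⟩ : ∃ k, k = x j := ⟨_, rfl⟩
      have hij : i ≠ j := by rw [hj]; exact hi.symm
      have hjk : j ≠ k := by
        rw [hk, hj]
        exact (x.injective.ne hi).symm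
      have hik : i ≠ k := by
        rintro rfl
        have := hx (Pi.single i 1 - Pi.single j 1) (by
          intro m
          by_cases hmi : m = i
          · subst hmi
            simp [← hj, hij, hij.symm]
          by_cases hmj : m = j
          · subst hmj
            simp [← hk, hij, hij.symm]
          have h1 : x m ≠ j := by rw [hj]; exact x.injective.ne hmi
          have h2 : x m ≠ i := by rw [hk]; exact x.injective.ne hmj
          simp [hmi, hmj, h1, h2])
        simpa [hij] using congrFun this i
      obtain ⟨y, hy⟩ : ∃ y, y = swap j k * (swap i j * x) := ⟨_, rfl⟩
      have hxy : x = swap i j * swap j k * y := by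
        rw [hy]
        simp [mul_assoc]
      have hyi : y i = i := by
        rw [hy, Perm.mul_apply, Perm.mul_apply, ← hj, swap_apply_right,
          swap_apply_of_ne_of_ne hij hik]
      have hyj : y j = j := by
        rw [hy, Perm.mul_apply, Perm.mul_apply, ← hk, swap_apply_of_ne_of_ne hik.symm hjk.symm,
          swap_apply_right]
      have hym : ∀ m, x m ≠ i → x m ≠ j → x m ≠ k → y m = x m := by
        intro m h1 h2 h3
        rw [hy, Perm.mul_apply, Perm.mul_apply, swap_apply_of_ne_of_ne h1 h2,
          swap_apply_of_ne_of_ne h2 h3]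
      have hyp : ∀ m, x m = i → y m = k := by
        intro m h1
        rw [hy, Perm.mul_apply, Perm.mul_apply, h1, swap_apply_left, swap_apply_left]
      have hr : absRank y + 2 ≤ absRank x := by
        have h1 := absRank_swap_mul_lt x i hi
        have h2 := absRank_swap_mul_lt (swap i (x i) * x) j (by
          rw [Perm.mul_apply, ← hj, ← hk, swap_apply_of_ne_of_ne hik.symm hjk.symm]
          exact hjk.symm)
        rw [Perm.mul_apply, ← hj, ← hk, swap_apply_of_ne_of_ne hik.symm hjk.symm, ← hy] at h2
        rw [← hj] at h1
        omega
      have hy' : ∀ f : α → ℚ, (∀ i, f (y i) = -f i) → f = 0 := by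
        intro f hf
        have hfi : f i = 0 := by
          have := hf i
          rw [hyi] at this
          linarith
        have hfj : f j = 0 := by
          have := hf j
          rw [hyj] at this
          linarith
        have hg := hx (fun m => if m = i then f k else if m = j then -f k else f m) (by
          intro m
          by_cases hmi : m = i
          · subst hmi
            simp [← hj, hij.symm]
          by_cases hmj : m = j
          · subst hmj
            simp [← hk, hik.symm, hjk.symm, hij.symm]
          have h1 : x m ≠ j := by rw [hj]; exact x.injective.ne hmi
          have h3 : x m ≠ k := by rw [hk]; exact x.injective.ne hmj
          simp only [hmi, hmj, h1, if_false]
          split_ifs with h2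
          · rw [← hf, hyp m h2]
          · rw [← hf, hym m h2 h1 h3])
        ext m
        have hgm := congrFun hg m
        simp only [Pi.zero_apply] at hgm ⊢
        split_ifs at hgm with h1 h2
        · rw [h1, hfi]
        · rw [h2, hfj]
        · exact hgm
      obtain ⟨l, hl, hp, hlen⟩ := ih _ (by omega) y hy' rfl
      refine ⟨(swap i j * swap j k) :: l, ?_, by rw [List.prod_cons, hp, ← hxy], ?_⟩
      · intro t ht
        rcases List.mem_cons.mp ht with rfl | ht
        · rw [swap_comm i j]
          exact Perm.isThreeCycle_swap_mul_swap_same hij.symm hjk hik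
        · exact hl t ht
      · rw [List.length_cons]
        omega
    · push Not at hne
      exact ⟨[], by simp, by ext i; simp [hne], by simp⟩

end ThreeCycles

section AlternatingGroup

variable {N : ℕ}

theorem oddCycles_of_hasOnlyOddCycles {x : Perm (Fin N)} (h : HasOnlyOddCycles x) :
    OddCycles x := by
  have ho : Odd (orderOf x) := by
    rw [← Perm.lcm_cycleType]
    have : ∀ s : Multiset ℕ, (∀ k ∈ s, Odd k) → Odd s.lcm := by
      intro s
      induction s using Multiset.induction_on with
      | empty => simp
      | cons k s ih =>
        intro hs
        rw [Multiset.lcm_cons]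
        exact ((hs k (Multiset.mem_cons_self k s)).mul
          (ih fun m hm => hs m (Multiset.mem_cons_of_mem hm))).of_dvd_nat
          (lcm_dvd (dvd_mul_right _ _) (dvd_mul_left _ _))
    exact this _ h
  exact oddCycles_of_exists fun i => ⟨orderOf x, ho, by simp [pow_orderOf_eq_one]⟩

theorem exists_threeCycles_list (x : alternatingGroup (Fin N)) :
    ∃ l : List (Perm (Fin N)), (∀ t ∈ l, t.IsThreeCycle) ∧ l.prod = x ∧
      l.length = wordLength (threeCycles N) x := by
  obtain ⟨w, hw, hT, rfl⟩ := exists_reduced_word (closure_threeCycles N) x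
  refine ⟨w.map Subtype.val, ?_, ?_, by rw [List.length_map, hw]⟩
  · intro t ht
    obtain ⟨s, hs, rfl⟩ := List.mem_map.mp ht
    exact hT s hs
  · exact (map_list_prod (alternatingGroup (Fin N)).subtype w).symm

theorem absRank_le_two_mul_wordLength (x : alternatingGroup (Fin N)) :
    absRank (x : Perm (Fin N)) ≤ 2 * wordLength (threeCycles N) x := by
  obtain ⟨l, hl, hp, hlen⟩ := exists_threeCycles_list x
  rw [← hp, ← hlen]
  exact absRank_le_of_list 2 l fun t ht => absRank_le_of_isThreeCycle (hl t ht)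

theorem OddCycles.two_mul_wordLength {x : alternatingGroup (Fin N)}
    (hx : OddCycles (x : Perm (Fin N))) :
    2 * wordLength (threeCycles N) x = absRank (x : Perm (Fin N)) := by
  apply le_antisymm _ (absRank_le_two_mul_wordLength x)
  obtain ⟨l, hl, hp, hlen⟩ := exists_threeCycle_list (x : Perm (Fin N)) (eq_zero_of_oddCycles hx)
  lift l to List (alternatingGroup (Fin N)) using fun t ht => (hl t ht).mem_alternatingGroup
  have hp' : l.prod = x := by
    apply Subtype.val_injective
    rw [← hp]
    exact map_list_prod (alternatingGroup (Fin N)).subtype l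
  have := wordLength_le (T := threeCycles N) l fun t ht => hl t (List.mem_map_of_mem ht)
  rw [hp'] at this
  rw [List.length_map] at hlen
  omega

theorem OddCycles.mem_alternatingGroup {x : Perm (Fin N)} (hx : OddCycles x) :
    x ∈ alternatingGroup (Fin N) := by
  obtain ⟨l, hl, rfl, -⟩ := exists_threeCycle_list x (eq_zero_of_oddCycles hx)
  exact Subgroup.list_prod_mem _ fun t ht => (hl t ht).mem_alternatingGroup

theorem order2_le_iff {x y : Perm (Fin N)} : (order2 N).le x y ↔ Below x y := by
  show wordLength (transpositions N) y = _ ↔ _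
  rw [below_iff, wordLength_transpositions, wordLength_transpositions, wordLength_transpositions]

theorem order3_le_iff {x y : alternatingGroup (Fin N)} : (order3 N).le x y ↔
    wordLength (threeCycles N) y =
      wordLength (threeCycles N) x + wordLength (threeCycles N) (x⁻¹ * y) := Iff.rfl

/-- In an interval of `≤₃` below a permutation with odd cycles, all word lengths are halves of the
corresponding ranks. -/
theorem two_mul_wordLength_of_le {x y : alternatingGroup (Fin N)}
    (hy : OddCycles (y : Perm (Fin N))) (h : (order3 N).le x y) :
    2 * wordLength (threeCycles N) x = absRank (x : Perm (Fin N)) ∧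
      2 * wordLength (threeCycles N) (x⁻¹ * y) = absRank ((x : Perm (Fin N))⁻¹ * (y : Perm (Fin N))) ∧
      Below (x : Perm (Fin N)) y := by
  rw [order3_le_iff] at h
  have h1 := hy.two_mul_wordLength
  have h2 := absRank_le_two_mul_wordLength x
  have h3 := absRank_le_two_mul_wordLength (x⁻¹ * y)
  have h4 := absRank_mul_le (x : Perm (Fin N)) ((x : Perm (Fin N))⁻¹ * y)
  rw [mul_inv_cancel_left] at h4
  rw [Subgroup.coe_mul, Subgroup.coe_inv] at h3
  rw [below_iff]
  omega

theorem oddDisp_of_le {x y : alternatingGroup (Fin N)} (hy : OddCycles (y : Perm (Fin N)))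
    (h : (order3 N).le x y) : OddDisp (x : Perm (Fin N)) y := by
  obtain ⟨h1, h2, h3⟩ := two_mul_wordLength_of_le hy h
  have hx : OddCycles (x : Perm (Fin N)) := by
    obtain ⟨l, hl, hp, hlen⟩ := exists_threeCycles_list x
    have := oddCycles_and_oddDisp_of_list l hl 1
      (oddCycles_of_exists fun i => ⟨1, odd_one, by simp⟩)
      (by rw [one_mul, absRank_one, hp, hlen, zero_add, h1])
    rw [one_mul, hp] at this
    exact this.1
  obtain ⟨l, hl, hp, hlen⟩ := exists_threeCycles_list (x⁻¹ * y)
  rw [Subgroup.coe_mul, Subgroup.coe_inv] at hp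
  have := oddCycles_and_oddDisp_of_list l hl x hx (by
    rw [hp, hlen, h2, mul_inv_cancel_left, below_iff.mp h3])
  rw [hp, mul_inv_cancel_left] at this
  exact this.2.2

theorem order3_le_of_oddDisp {x y : alternatingGroup (Fin N)} (hy : OddCycles (y : Perm (Fin N)))
    (h : Below (x : Perm (Fin N)) y) (hd : OddDisp (x : Perm (Fin N)) y) : (order3 N).le x y := by
  have hx := (hd.oddCycles h hy).two_mul_wordLength
  have hk := (hd.complement h hy).oddCycles h.complement hy
  have hk' : OddCycles ((x⁻¹ * y : alternatingGroup (Fin N)) : Perm (Fin N)) := by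
    have := hk.conj (x : Perm (Fin N))⁻¹
    simpa [mul_assoc] using this
  have hk' := hk'.two_mul_wordLength
  have hy := hy.two_mul_wordLength
  rw [below_iff] at h
  rw [Subgroup.coe_mul, Subgroup.coe_inv] at hk'
  rw [order3_le_iff]
  omega

theorem isInducedSubposet_interval {x : alternatingGroup (Fin N)}
    (hx : OddCycles (x : Perm (Fin N))) :
    IsInducedSubposet (order3 N) (order2 N) (fun u => (u : Perm (Fin N)))
      (interval3 1 x) (interval2 1 (x : Perm (Fin N))) where
  injOn := Subtype.val_injective.injOn
  mapsTo u hu := ⟨order2_le_iff.mpr (one_below _),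
    order2_le_iff.mpr (two_mul_wordLength_of_le hx hu.2).2.2⟩
  le_iff_le u hu v hv := by
    have hvb := (two_mul_wordLength_of_le hx hv.2).2.2
    have hvd := oddDisp_of_le hx hv.2
    have hvo := hvd.oddCycles hvb hx
    rw [order2_le_iff]
    refine ⟨fun h => (two_mul_wordLength_of_le hvo h).2.2, fun h => ?_⟩
    exact order3_le_of_oddDisp hvo h (hvd.of_below hvb h.refines (oddDisp_of_le hx hu.2))

end AlternatingGroup

section Noncrossing

variable {N : ℕ}

theorem finRotate_pow_apply (n : ℕ) (i : Fin N) :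
    ((finRotate N ^ n) i : ℕ) = (i + n) % N := by
  induction n with
  | zero => simp [Nat.mod_eq_of_lt i.2]
  | succ n ih =>
    have := i.neZero
    rw [pow_succ', Perm.mul_apply, finRotate_apply, Fin.val_add, ih, Fin.val_one', ← Nat.add_mod,
      add_assoc]

theorem cycleLength_finRotate (i : Fin N) : cycleLength (finRotate N) i = N := by
  have hN := i.pos
  have h : ∀ n, cycleLength (finRotate N) i ∣ n ↔ N ∣ n := by
    intro n
    rw [cycleLength_dvd_iff, Fin.ext_iff, finRotate_pow_apply]
    nth_rewrite 2 [← Nat.mod_eq_of_lt i.2]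
    rw [← (Nat.modEq_zero_iff_dvd (a := n) (n := N))]
    exact ⟨fun h => Nat.ModEq.add_left_cancel' (i : ℕ) h, fun h => Nat.ModEq.add_left (i : ℕ) h⟩
  exact Nat.dvd_antisymm ((h N).mpr dvd_rfl) ((h _).mp dvd_rfl)

theorem disp_finRotate (u : Perm (Fin N)) (i : Fin N) :
    (disp (finRotate N) u i : ℤ) = (u i : ℤ) - i + N * if u i ≤ i then 1 else 0 := by
  have h1 := i.2
  have h2 := (u i).2
  split_ifs with h
  · rw [Fin.le_def] at h
    rw [disp_eq (d := N + u i - i) (by omega) (by rw [cycleLength_finRotate]; omega)]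
    · push_cast [show (i : ℕ) ≤ N + u i by omega]
      ring
    · rw [Fin.ext_iff, finRotate_pow_apply, show (i : ℕ) + (N + u i - i) = N + u i by omega,
        Nat.add_mod_left, Nat.mod_eq_of_lt h2]
  · rw [Fin.le_def] at h
    rw [disp_eq (d := u i - i) (by omega) (by rw [cycleLength_finRotate]; omega)]
    · push_cast [show (i : ℕ) ≤ u i by omega]
      ring
    · rw [Fin.ext_iff, finRotate_pow_apply, show (i : ℕ) + (u i - i) = u i by omega,
        Nat.mod_eq_of_lt h2]

theorem odd_sum_range_iff {f : ℕ → ℤ} (hf : ∀ s, Odd (f s)) (d : ℕ) :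
    Odd (∑ s ∈ Finset.range d, f s) ↔ Odd d := by
  induction d with
  | zero => simp
  | succ d ih =>
    rw [Finset.sum_range_succ, Int.odd_add', ← Int.not_odd_iff_even, ih, Nat.odd_add_one]
    simp [hf d]

/-- Rising steps of `x` are odd, and the other ones are even. -/
def AlternatingParity (x : Perm (Fin N)) : Prop :=
  ∀ i, Odd ((x i : ℤ) - i + if x i ≤ i then 1 else 0)

theorem AlternatingParity.oddDisp {u v : Perm (Fin N)} (hv : Below v (finRotate N))
    (huv : Below u v) (hu' : AlternatingParity u) (hv' : AlternatingParity v) : OddDisp u v := by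
  intro i
  obtain ⟨d, hd⟩ : ∃ d, d = disp v u i := ⟨_, rfl⟩
  rw [← hd]
  have htel : ∑ s ∈ Finset.range d, (((v ((v ^ s) i) : ℕ) : ℤ) - ((v ^ s) i : ℕ)) =
      (u i : ℤ) - i := by
    have : ∀ n, ∑ s ∈ Finset.range n, (((v ((v ^ s) i) : ℕ) : ℤ) - ((v ^ s) i : ℕ)) =
        ((v ^ n) i : ℤ) - i := by
      intro n
      induction n with
      | zero => simp
      | succ n ih =>
        rw [Finset.sum_range_succ, ih, pow_succ', Perm.mul_apply]
        ring
    rw [this, hd, pow_disp_apply (huv.refines i)]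
  have hchain := hv.disp_chain huv.refines i
  rw [← hd] at hchain
  have hchain := congrArg (Nat.cast : ℕ → ℤ) hchain
  rw [Nat.cast_sum, disp_finRotate, Finset.sum_congr rfl fun s _ => disp_finRotate v _] at hchain
  rw [Finset.sum_add_distrib, htel, ← Finset.mul_sum] at hchain
  have hN : (N : ℤ) ≠ 0 := by
    have := i.pos
    omega
  have hwrap := mul_left_cancel₀ hN (add_left_cancel hchain)
  have h1 := hu' i
  rw [hwrap, ← htel, ← Finset.sum_add_distrib, odd_sum_range_iff fun s => hv' _] at h1
  exact h1

theorem alternatingParity_one : AlternatingParity (1 : Perm (Fin N)) := by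
  intro i
  simp

theorem getElem_parity_of_isChain {u : List ℕ} (hc : u.IsChain fun (a b : ℕ) =>
    Odd ((b : ℤ) - (a : ℤ))) (k : ℕ) (hk : k < u.length) :
    Even ((u[k] : ℤ) - (u[0] : ℤ) - k) := by
  induction k with
  | zero => simp
  | succ k ih =>
    have h1 := ih (by omega)
    have h2 : Odd ((u[k + 1] : ℤ) - (u[k] : ℤ)) := List.isChain_iff_getElem.mp hc k hk
    have h3 : (u[k + 1] : ℤ) - (u[0] : ℤ) - ((k + 1 : ℕ) : ℤ) =
        (u[k] : ℤ) - (u[0] : ℤ) - k + ((u[k + 1] : ℤ) - (u[k] : ℤ) - 1) := by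
      push_cast
      ring
    rw [h3]
    exact h1.add (h2.sub_odd odd_one)

theorem alternatingParity_of_isODCycle {x : Perm (Fin N)}
    (hx : ∀ σ ∈ x.cycleFactorsFinset, IsODCycle σ) : AlternatingParity x := by
  intro i
  by_cases hi : x i = i
  · simp [hi]
  obtain ⟨l, hinc, hperm, hodd, hchain⟩ :=
    hx (x.cycleOf i) (Perm.cycleOf_mem_cycleFactorsFinset_iff.mpr (Perm.mem_support.mpr hi))
  replace hchain : (l.map Fin.val).IsChain fun (a b : ℕ) => Odd ((b : ℤ) - (a : ℤ)) := by
    simpa [List.map_eq_flatMap] using hchain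
  have hxi : l.formPerm i = x i := by rw [hperm, Perm.cycleOf_apply_self]
  have hmem : i ∈ l := List.mem_of_formPerm_apply_ne (by rwa [hxi])
  obtain ⟨k, hk, rfl⟩ := List.getElem_of_mem hmem
  rw [List.formPerm_apply_getElem l (hinc.imp ne_of_lt) k hk] at hxi
  rw [← hxi]
  by_cases hk' : k + 1 < l.length
  · simp only [Nat.mod_eq_of_lt hk']
    rw [if_neg (not_le.mpr (List.pairwise_iff_getElem.mp hinc k (k + 1) hk hk' (by omega))),
      add_zero]
    have h := List.isChain_iff_getElem.mp hchain k (by simpa using hk')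
    rw [List.getElem_map, List.getElem_map] at h
    exact h
  · have hk2 : k + 1 = l.length := by omega
    simp only [hk2, Nat.mod_self]
    have h0 := getElem_parity_of_isChain hchain k (by simpa using hk)
    simp only [List.getElem_map] at h0
    have hle : l[0] ≤ l[k] := by
      rcases Nat.eq_zero_or_pos k with rfl | h
      · exact le_rfl
      · exact (List.pairwise_iff_getElem.mp hinc 0 k (by omega) hk h).le
    rw [if_pos hle]
    have hke : Even (k : ℤ) := by
      rw [← hk2, Nat.odd_add_one, Nat.not_odd_iff_even] at hodd
      exact_mod_cast hodd
    have := (h0.add hke).neg.add_one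
    convert this using 1
    ring

theorem below_finRotate_of_mem_ONC {x : Perm (Fin N)} (hx : x ∈ ONC N) :
    Below x (finRotate N) :=
  order2_le_iff.mp hx.1

theorem oddCycles_of_mem_ONC {x : Perm (Fin N)} (hx : x ∈ ONC N) : OddCycles x :=
  oddDisp_one_iff.mp (alternatingParity_one.oddDisp (below_finRotate_of_mem_ONC hx) (one_below x)
    (alternatingParity_of_isODCycle hx.2))

theorem isInducedSubposet_ONC :
    IsInducedSubposet (order3 N) (order2 N) (fun u => (u : Perm (Fin N)))
      {u : alternatingGroup (Fin N) | (u : Perm (Fin N)) ∈ ONC N} (NC N) where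
  injOn := Subtype.val_injective.injOn
  mapsTo u hu := hu.1
  le_iff_le u hu v hv := by
    have hvo := oddCycles_of_mem_ONC hv
    rw [order2_le_iff]
    refine ⟨fun h => (two_mul_wordLength_of_le hvo h).2.2, fun h => ?_⟩
    exact order3_le_of_oddDisp hvo h
      ((alternatingParity_of_isODCycle hu.2).oddDisp (below_finRotate_of_mem_ONC hv) h
        (alternatingParity_of_isODCycle hv.2))

end Noncrossing

theorem mainTheorem5 (N : ℕ) (hN : 3 ≤ N) :
    (∀ x : alternatingGroup (Fin N), HasOnlyOddCycles (x : Perm (Fin N)) →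
      IsInducedSubposet (order3 N) (order2 N) (fun u => (u : Perm (Fin N)))
        (interval3 1 x) (interval2 1 (x : Perm (Fin N)))) ∧
    (ONC N ⊆ {u | u ∈ alternatingGroup (Fin N)} ∧
      IsInducedSubposet (order3 N) (order2 N) (fun u => (u : Perm (Fin N)))
        {u : alternatingGroup (Fin N) | (u : Perm (Fin N)) ∈ ONC N} (NC N)) :=
  ⟨fun _ hx => isInducedSubposet_interval (oddCycles_of_hasOnlyOddCycles hx),
    fun _ hx => (oddCycles_of_mem_ONC hx).mem_alternatingGroup, isInducedSubposet_ONC⟩
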